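/- Let $X$ be a set and let $\mathcal H$ be a reproducing kernel Hilbert space of complex-valued functions on $X$ with reproducing kernel $k$. Let $$\mathrm{Mult}(\mathcal H)=\{\varphi:X\to\mathbb C:\ \varphi f\in\mathcal H\text{ for all }f\in\mathcal H\}$$ be its multiplier algebra; each $\varphi\in\mathrm{Mult}(\mathcal H)$ defines a bounded multiplication operator $M_\varphi$ on $\mathcal H$. Call $\psi\in\mathrm{Mult}(\mathcal H)$ cyclic if $M_\psi$ has dense range, and put $$N^+(\mathcal H)=\Big\{\frac{\varphi}{\psi}:\ \varphi,\psi\in\mathrm{Mult}(\mathcal H),\ \psi\text{ cyclic}\Big\}.$$ Assume that $\mathcal H$ is normalized, i.e. there is $x_0\in X$ with $k(x,x_0)=1$ for all $x\in X$ (cyclic multipliers then vanish nowhere, so these quotients are defined on all of $X$), and that $\mathcal H$ is a complete Pick space, i.e. for all $r,n\in\mathbb N$, $z_1,\dots,z_n\in X$ and $W_1,\dots,W_n\in M_r(\mathbb C)$, positive semidefiniteness of the block matrix $\big[k(z_i,z_j)(I-W_iW_j^*)\big]_{i,j=1}^n$ implies that there is $\Phi\in M_r(\mathrm{Mult}(\mathcal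 H))$, of norm at most $1$ as an operator on $\mathcal H^r$, with $\Phi(z_i)=W_i$ for $i=1,\dots,n$. For a class $S$ of functions on $X$, a subset $Z\subset X$ is called a zero set for $S$ if some function in $S$ vanishes exactly on $Z$. Then for every $Z\subset X$ the following are equivalent: $Z$ is a zero set for $\mathcal H$; $Z$ is a zero set for $\mathrm{Mult}(\mathcal H)$; $Z$ is a zero set for $N^+(\mathcal H)$. In particular, if $Z_1$ and $Z_2$ are zero sets for $\mathcal H$, then $Z_1\cup Z_2$ is a zero set for $\mathcal H$. -/

import Mathlib

noncomputable section

namespace CompletePick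

open scoped ComplexOrder

variable {X : Type*} (H : Type*) [NormedAddCommGroup H] [InnerProductSpace ℂ H] [RKHS ℂ H X ℂ]

/-- The multiplier algebra of a space `H` of functions on `X`: all `φ : X → ℂ` such that
`φ f ∈ H` for all `f ∈ H`. -/
def Mult : Subalgebra ℂ (X → ℂ) where
  carrier := {φ | ∀ f : H, ∃ g : H, ⇑g = φ * ⇑f}
  mul_mem' := by
    intro φ ψ hφ hψ f
    obtain ⟨g, hg⟩ := hψ f
    obtain ⟨h, hh⟩ := hφ g
    exact ⟨h, by rw [hh, hg, mul_assoc]⟩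
  add_mem' := by
    intro φ ψ hφ hψ f
    obtain ⟨g, hg⟩ := hφ f
    obtain ⟨h, hh⟩ := hψ f
    exact ⟨g + h, by rw [RKHS.coe_add, hg, hh, add_mul]⟩
  algebraMap_mem' := by
    intro c f
    exact ⟨c • f, by rw [RKHS.coe_smul, Algebra.algebraMap_eq_smul_one, smul_mul_assoc, one_mul]⟩

variable {H}

/-- The product `φ f` of a multiplier `φ` and `f ∈ H`, as an element of `H`. -/
def mulFun (φ : Mult H) (f : H) : H := Classical.choose (φ.2 f)

theorem mulFun_apply (φ : Mult H) (f : H) (x : X) : mulFun φ f x = (φ : X → ℂ) x * f x :=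
  congrFun (Classical.choose_spec (φ.2 f)) x

/-- The multiplication operator `f ↦ φ f` of a multiplier `φ`, as a linear map. -/
def mulLinear (φ : Mult H) : H →ₗ[ℂ] H where
  toFun := mulFun φ
  map_add' f g := by
    ext x
    simp [mulFun_apply, mul_add]
  map_smul' c f := by
    ext x
    simp [mulFun_apply, mul_left_comm]

theorem mulLinear_apply (φ : Mult H) (f : H) (x : X) :
    mulLinear φ f x = (φ : X → ℂ) x * f x :=
  mulFun_apply φ f x

variable [CompleteSpace H]

/-- The multiplication operator `M_φ` as a bounded operator on `H`; boundedness is the closed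
graph theorem. -/
def mulOp (φ : Mult H) : H →L[ℂ] H :=
  ContinuousLinearMap.ofSeqClosedGraph (g := mulLinear φ) (by
    intro u f g hu hg
    apply DFunLike.coe_injective
    funext x
    have h1 := ((RKHS.continuous_eval (𝕜 := ℂ) x).tendsto g).comp hg
    have h2 := (((RKHS.continuous_eval (𝕜 := ℂ) x).tendsto f).comp hu).const_mul
      ((φ : X → ℂ) x)
    rw [mulLinear_apply]
    refine tendsto_nhds_unique h1 (h2.congr fun n => ?_)
    exact (mulLinear_apply φ (u n) x).symm)

theorem mulOp_apply (φ : Mult H) (f : H) (x : X) :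
    mulOp φ f x = (φ : X → ℂ) x * f x :=
  mulLinear_apply φ f x

/-- The operator on the Hilbert space `H ⊕ ⋯ ⊕ H` (`r` summands) given by an `r × r` matrix of
multipliers. Its operator norm is the norm of the matrix in `M_r(Mult(H))`. -/
def matrixMulOp {r : ℕ} (Φ : Matrix (Fin r) (Fin r) (Mult H)) :
    PiLp 2 (fun _ : Fin r => H) →L[ℂ] PiLp 2 (fun _ : Fin r => H) :=
  ((PiLp.continuousLinearEquiv 2 ℂ (fun _ : Fin r => H)).symm :
      (Fin r → H) →L[ℂ] PiLp 2 (fun _ : Fin r => H)) ∘L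
    ContinuousLinearMap.pi fun i => ∑ j, mulOp (Φ i j) ∘L PiLp.proj 2 (fun _ : Fin r => H) j

theorem matrixMulOp_apply {r : ℕ} (Φ : Matrix (Fin r) (Fin r) (Mult H))
    (F : PiLp 2 (fun _ : Fin r => H)) (i : Fin r) :
    matrixMulOp Φ F i = ∑ j, mulOp (Φ i j) (F j) := by
  simp [matrixMulOp]

/-- A multiplier is cyclic if its multiplication operator has dense range. -/
def IsCyclic (ψ : Mult H) : Prop := DenseRange (mulOp ψ)

variable (H)

/-- The scalar reproducing kernel: `k(z, w) = k_w(z)` where `⟨f, k_w⟩ = f(w)` for all `f ∈ H`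
(inner product linear in the first entry). -/
def ker (z w : X) : ℂ := RKHS.kernel H z w 1

/-- The kernel of `H` is normalized at some point `x₀`: `k(x, x₀) = 1` for all `x`. -/
def IsNormalized : Prop := ∃ x₀ : X, ∀ x : X, ker H x x₀ = 1

/-- The complete Pick property: whenever the block matrix `[k(z_i, z_j) (I - W_i W_j^*)]` is
positive semidefinite, some `Φ` in the closed unit ball of `M_r(Mult(H))` has `Φ(z_i) = W_i`. -/
def IsCompletePick : Prop :=
  ∀ (r n : ℕ) (z : Fin n → X) (W : Fin n → Matrix (Fin r) (Fin r) ℂ),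
    (Matrix.of fun p q : Fin n × Fin r =>
      ker H (z p.1) (z q.1) *
        ((1 : Matrix (Fin r) (Fin r) ℂ) - W p.1 * (W q.1).conjTranspose) p.2 q.2).PosSemidef →
    ∃ Φ : Matrix (Fin r) (Fin r) (Mult H), ‖matrixMulOp Φ‖ ≤ 1 ∧
      ∀ (i : Fin n) (a b : Fin r), (Φ a b : X → ℂ) (z i) = W i a b

/-- The functions on `X` belonging to `H`. -/
def functions : Set (X → ℂ) := Set.range fun f : H => ⇑f

/-- The Smirnov class `N⁺(H)`: quotients `φ / ψ` of multipliers with `ψ` cyclic. -/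
def Smirnov : Set (X → ℂ) :=
  {f | ∃ φ ψ : Mult H, IsCyclic ψ ∧ f = (φ : X → ℂ) / (ψ : X → ℂ)}

/-- `Z` is a zero set for the class `S` if some function in `S` vanishes exactly on `Z`. -/
def IsZeroSet {X : Type*} (S : Set (X → ℂ)) (Z : Set X) : Prop :=
  ∃ f ∈ S, ∀ x, f x = 0 ↔ x ∈ Z

end CompletePick

end

/-!
The main point is that every `f ≠ 0` in `H` has the same zeros as some multiplier. Compressing the
contractive row multipliers supplied by the complete Pick property to the subspaces
`{g ∈ H | g(y) = 0}` and inducting on the number of points, one finds that `1 - 1 / k` is positive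
semidefinite (McCullough–Quiggin), so `k(x, z) = 1 / (1 - ⟪b x, b z⟫)` with `‖b z‖ < 1`. Then
`k(·, z) f ∈ H` is obtained by inverting `1 - ⟪b ·, b z⟫` in the multiplier algebra, and
`φ(z) = f(z) / ⟪k(·, z) f, f⟫` is a multiplier whose denominator vanishes nowhere. Conversely `H`
contains the constant `1`, hence all multipliers; and as evaluations are continuous and do not kill
`1`, a cyclic multiplier has no zeros.
-/

open scoped ComplexOrder ComplexConjugate InnerProductSpace

namespace CompletePick

section InnerProduct

variable {𝕜 E : Type*} [RCLike 𝕜] [NormedAddCommGroup E] [InnerProductSpace 𝕜 E]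

theorem inner_ne_zero_of_norm_sub_le {g f : E} (h : ‖g - f‖ ≤ ‖g‖) (hf : f ≠ 0) :
    ⟪g, f⟫_𝕜 ≠ 0 := by
  intro h0
  have pythagoras : ‖g - f‖ ^ 2 = ‖g‖ ^ 2 + ‖f‖ ^ 2 := by
    rw [norm_sub_sq (𝕜 := 𝕜), h0]
    simp
  have := pow_le_pow_left₀ (norm_nonneg _) h 2
  have := norm_pos_iff.mpr hf
  nlinarith

theorem inner_eq_zero_of_unimodular_eigenvector [CompleteSpace E] {T : E →L[𝕜] E} (hT : ‖T‖ ≤ 1)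
    {α β : 𝕜} (hα : ‖α‖ = 1) (hαβ : α ≠ β) {u v : E} (hu : T u = α • u) (hv : T v = β • v) :
    ⟪u, v⟫_𝕜 = 0 := by
  have norm_le (w : E) : ‖T.adjoint w‖ ≤ ‖w‖ := by
    simpa using T.adjoint.le_of_opNorm_le ((LinearIsometryEquiv.norm_map _ T).trans_le hT) w
  have adjoint_eigenvector : T.adjoint u = conj α • u := by
    refine eq_of_norm_le_re_inner_eq_norm_sq (𝕜 := 𝕜) ?_ ?_
    · simpa [norm_smul, hα] using norm_le u
    · rw [inner_smul_right, ContinuousLinearMap.adjoint_inner_left, hu, inner_smul_right,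
        ← mul_assoc, RCLike.conj_mul, inner_self_eq_norm_sq_to_K, norm_smul, RCLike.norm_conj, hα]
      norm_cast
      simp
  have intertwine : α * ⟪u, v⟫_𝕜 = β * ⟪u, v⟫_𝕜 := by
    rw [← inner_smul_right u v β, ← hv, ← ContinuousLinearMap.adjoint_inner_left,
      adjoint_eigenvector, inner_smul_left, RCLike.conj_conj]
  exact (mul_eq_mul_right_iff.mp intertwine).resolve_left hαβ

end InnerProduct

section PosSemidef

variable {ι 𝕜 E F : Type*} [RCLike 𝕜] [NormedAddCommGroup E] [InnerProductSpace 𝕜 E]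
  [NormedAddCommGroup F] [InnerProductSpace 𝕜 F]

theorem posSemidef_of_forall_fin_submatrix {M : Matrix ι ι 𝕜}
    (h : ∀ (n : ℕ) (z : Fin n → ι), (M.submatrix z z).PosSemidef) : M.PosSemidef := by
  classical
  refine ⟨?_, fun c => ?_⟩
  · ext x y
    simpa using (h 2 ![x, y]).1.apply 0 1
  · have support_posSemidef : (M.submatrix (↑) (↑) : Matrix c.support c.support 𝕜).PosSemidef := by
      simpa [Matrix.submatrix_submatrix, Function.comp_def] using
        (h _ fun i => (c.support.equivFin.symm i : ι)).submatrix c.support.equivFin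
    simpa [Finsupp.sum, ← Finset.sum_attach c.support, ← Finset.subtype_mem_eq_attach,
      ← Finsupp.subtypeDomain_apply, ← Finsupp.support_subtypeDomain] using support_posSemidef.2 _

theorem posSemidef_gram (v : ι → E) : (Matrix.gram 𝕜 v).PosSemidef :=
  posSemidef_of_forall_fin_submatrix fun _ z => Matrix.posSemidef_gram 𝕜 (v ∘ z)

theorem posSemidef_gram_sub_gram_comp {T : E →L[𝕜] F} (hT : ‖T‖ ≤ 1) (v : ι → E) :
    (Matrix.gram 𝕜 v - Matrix.gram 𝕜 (T ∘ v)).PosSemidef := by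
  have hT' : 0 ≤ 1 - ‖T‖ ^ 2 := sub_nonneg.mpr (pow_le_one₀ (norm_nonneg T) hT)
  convert (Matrix.posSemidef_opNorm_smul_gram_sub_gram (𝕜 := 𝕜) v T).add
    ((posSemidef_gram (𝕜 := 𝕜) v).smul hT') using 1
  module

theorem sum_star_mul_gram_mul (v : ι → E) (c : ι →₀ 𝕜) :
    (c.sum fun i a => c.sum fun j b => star a * Matrix.gram 𝕜 v i j * b) =
      ((‖Finsupp.linearCombination 𝕜 v c‖ ^ 2 : ℝ) : 𝕜) := by
  rw [RCLike.ofReal_pow, ← inner_self_eq_norm_sq_to_K (𝕜 := 𝕜)]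
  simp only [Finsupp.linearCombination_apply, Finsupp.sum_inner, Finsupp.inner_sum,
    inner_smul_left, inner_smul_right, Matrix.gram_apply, Finsupp.mul_sum]
  rw [Finsupp.sum_comm]
  refine Finsupp.sum_congr fun i _ => Finsupp.sum_congr fun j _ => ?_
  rw [RCLike.star_def]
  ring

theorem norm_linearCombination_le_of_posSemidef {v : ι → E} {u : ι → F}
    (h : (Matrix.gram 𝕜 v - Matrix.gram 𝕜 u).PosSemidef) (c : ι →₀ 𝕜) :
    ‖Finsupp.linearCombination 𝕜 u c‖ ≤ ‖Finsupp.linearCombination 𝕜 v c‖ := by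
  have quadratic_form : (c.sum fun i a => c.sum fun j b =>
      star a * (Matrix.gram 𝕜 v - Matrix.gram 𝕜 u) i j * b) =
      ((‖Finsupp.linearCombination 𝕜 v c‖ ^ 2 -
        ‖Finsupp.linearCombination 𝕜 u c‖ ^ 2 : ℝ) : 𝕜) := by
    rw [RCLike.ofReal_sub, ← sum_star_mul_gram_mul, ← sum_star_mul_gram_mul]
    simp only [Finsupp.sum, Matrix.sub_apply, mul_sub, sub_mul, Finset.sum_sub_distrib]
  have nonneg := h.2 c
  rw [quadratic_form, RCLike.ofReal_nonneg, sub_nonneg] at nonneg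
  exact le_of_sq_le_sq nonneg (norm_nonneg _)

theorem posSemidef_of_rescale {M : Matrix ι ι 𝕜} {d : ι → 𝕜} (hd : ∀ i, d i ≠ 0)
    (h : (Matrix.of fun i j => d i * M i j * conj (d j)).PosSemidef) : M.PosSemidef := by
  convert (posSemidef_gram (𝕜 := 𝕜) fun i => conj (d i)⁻¹).hadamard h using 1
  ext i j
  have := hd i
  have : conj (d j) ≠ 0 := (map_ne_zero _).mpr (hd j)
  simp only [Matrix.hadamard_apply, Matrix.gram_apply, Matrix.of_apply, RCLike.inner_apply,
    RCLike.conj_conj, map_inv₀]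
  field_simp

theorem exists_eq_gram.{u, v} {ι : Type u} {𝕜 : Type v} [RCLike 𝕜] {M : Matrix ι ι 𝕜}
    (hM : M.PosSemidef) :
    ∃ (G : Type (max u v)) (_ : NormedAddCommGroup G) (_ : InnerProductSpace 𝕜 G) (b : ι → G),
      M = Matrix.gram 𝕜 b := by
  let K : Matrix ι ι (𝕜 →L[𝕜] 𝕜) := M.map fun a => a • (1 : 𝕜 →L[𝕜] 𝕜)
  have conj_entry (x y : ι) : conj (M x y) = M y x := hM.1.apply y x
  have hK : K.PosSemidef := by
    have tfae := (RKHS.posSemidef_tfae (K := K)).out 0 2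
    refine tfae.mpr ⟨?_, fun v => ?_⟩
    · ext x y
      simp [K, Matrix.conjTranspose_apply, conj_entry]
    · refine (RCLike.nonneg_iff.mp (hM.2 v)).1.trans_eq (congrArg RCLike.re ?_)
      refine Finsupp.sum_congr fun x _ => Finsupp.sum_congr fun y _ => ?_
      simp [K, conj_entry, mul_left_comm, mul_comm]
  have : Fact K.PosSemidef := ⟨hK⟩
  refine ⟨RKHS.OfKernel K, inferInstance, inferInstance,
    fun x => RKHS.kerFun (RKHS.OfKernel K) x 1, ?_⟩
  ext x y
  rw [Matrix.gram_apply, ← RKHS.kernel_inner, RKHS.OfKernel.kernel_ofKernel]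
  simp [K, conj_entry]

theorem posSemidef_of_zero_row_col {n : ℕ} {M : Matrix (Fin (n + 1)) (Fin (n + 1)) 𝕜}
    (hrow : ∀ j, M 0 j = 0) (hcol : ∀ i, M i 0 = 0)
    (h : (M.submatrix Fin.succ Fin.succ).PosSemidef) : M.PosSemidef := by
  obtain ⟨G, _, _, b, hb⟩ := exists_eq_gram h
  have eq_gram : M = Matrix.gram 𝕜 (Fin.cons 0 b : Fin (n + 1) → G) := by
    ext i j
    cases i using Fin.cases with
    | zero => simp [Matrix.gram_apply, hrow]
    | succ i =>
      cases j using Fin.cases with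
      | zero => simp [Matrix.gram_apply, hcol]
      | succ j => exact congrFun₂ hb i j
  exact eq_gram ▸ posSemidef_gram _

end PosSemidef

section Kernel

variable {X : Type*} (H : Type*) [NormedAddCommGroup H] [InnerProductSpace ℂ H] [RKHS ℂ H X ℂ]
  [CompleteSpace H]

/-- The kernel function `k(·, x)` as an element of `H`. -/
noncomputable def kerVec (x : X) : H := RKHS.kerFun H x 1

variable {H}

theorem inner_kerVec (x : X) (f : H) : ⟪kerVec H x, f⟫_ℂ = f x := by
  simp [kerVec]

theorem kerVec_apply (x y : X) : kerVec H y x = ker H x y := by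
  rw [kerVec, RKHS.kerFun_apply, ker]

theorem inner_kerVec_kerVec (x y : X) : ⟪kerVec H x, kerVec H y⟫_ℂ = ker H x y := by
  rw [inner_kerVec, kerVec_apply]

theorem conj_ker (x y : X) : conj (ker H x y) = ker H y x := by
  rw [← inner_kerVec_kerVec, inner_conj_symm, inner_kerVec_kerVec]

theorem ker_self (x : X) : ker H x x = (‖kerVec H x‖ : ℂ) ^ 2 := by
  rw [← inner_kerVec_kerVec, inner_self_eq_norm_sq_to_K]
  rfl

variable (H) in
theorem gram_kerVec : Matrix.gram ℂ (kerVec H : X → H) = .of (ker H) := by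
  ext x y
  rw [Matrix.gram_apply, inner_kerVec_kerVec, Matrix.of_apply]

variable (H) in
theorem denseRange_linearCombination_kerVec :
    DenseRange (Finsupp.linearCombination ℂ (kerVec H : X → H)) := by
  have dense_kerFun := RKHS.kerFun_dense (𝕜 := ℂ) (V := ℂ) (X := X) H
  rw [DenseRange, ← LinearMap.coe_range, Finsupp.range_linearCombination,
    Submodule.dense_iff_topologicalClosure_eq_top, ← top_le_iff, ← dense_kerFun]
  refine Submodule.topologicalClosure_mono (Submodule.span_le.mpr ?_)
  rintro _ ⟨x, c, rfl⟩
  have kerFun_eq_smul : RKHS.kerFun H x c = c • kerVec H x := by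
    rw [kerVec, ← map_smul, smul_eq_mul, mul_one]
  exact kerFun_eq_smul ▸ Submodule.smul_mem _ _ (Submodule.subset_span ⟨x, rfl⟩)

variable {E : Type*} [NormedAddCommGroup E] [InnerProductSpace ℂ E] [CompleteSpace E]

theorem exists_clm_kerVec_eq {v : X → E}
    (hv : (Matrix.gram ℂ (kerVec H : X → H) - Matrix.gram ℂ v).PosSemidef) :
    ∃ T : H →L[ℂ] E, ‖T‖ ≤ 1 ∧ ∀ x, T (kerVec H x) = v x := by
  have dense := denseRange_linearCombination_kerVec (X := X) H
  have bound (c : X →₀ ℂ) : ‖Finsupp.linearCombination ℂ v c‖ ≤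
      1 * ‖Finsupp.linearCombination ℂ (kerVec H) c‖ :=
    (norm_linearCombination_le_of_posSemidef hv c).trans_eq (one_mul _).symm
  refine ⟨(Finsupp.linearCombination ℂ v).extendOfNorm (Finsupp.linearCombination ℂ (kerVec H)),
    ContinuousLinearMap.opNorm_le_bound _ zero_le_one
      (LinearMap.norm_extendOfNorm_apply_le dense 1 bound), fun x => ?_⟩
  simpa using LinearMap.extendOfNorm_eq dense ⟨1, bound⟩ (Finsupp.single x 1)

theorem adjoint_apply_eq_inner (T : H →L[ℂ] E) (ξ : E) (x : X) :
    T.adjoint ξ x = ⟪T (kerVec H x), ξ⟫_ℂ := by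
  rw [← inner_kerVec, ContinuousLinearMap.adjoint_inner_right]

end Kernel

section Row

variable {X ι : Type*} [Fintype ι] {H : Type*} [NormedAddCommGroup H] [InnerProductSpace ℂ H]
  [RKHS ℂ H X ℂ] [CompleteSpace H]

variable (H) in
/-- The matrix `k(z, w) (1 - ∑ b, φ_b(z) conj φ_b(w))`, whose positive semidefiniteness says that
the row `(φ_b)` defines a contraction `H ⊕ ⋯ ⊕ H → H`. -/
noncomputable def rowDefect (φ : ι → X → ℂ) : Matrix X X ℂ :=
  .of fun z w => ker H z w * (1 - ∑ b, φ b z * conj (φ b w))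

/-- The contraction is the adjoint of the row operator `(f_b) ↦ ∑ b, φ_b f_b`. -/
theorem posSemidef_rowDefect_iff {φ : ι → X → ℂ} :
    (rowDefect H φ).PosSemidef ↔ ∃ R : H →L[ℂ] PiLp 2 (fun _ : ι => H), ‖R‖ ≤ 1 ∧
      ∀ x b, R (kerVec H x) b = conj (φ b x) • kerVec H x := by
  let v (x : X) : PiLp 2 (fun _ : ι => H) := WithLp.toLp 2 fun b => conj (φ b x) • kerVec H x
  have rowDefect_eq : rowDefect H φ = Matrix.gram ℂ (kerVec H) - Matrix.gram ℂ v := by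
    ext z w
    simp only [rowDefect, v, Matrix.of_apply, Matrix.sub_apply, Matrix.gram_apply,
      PiLp.inner_apply, inner_smul_left, inner_smul_right, inner_kerVec_kerVec, Complex.conj_conj,
      mul_sub, mul_one, Finset.mul_sum, sub_right_inj]
    exact Finset.sum_congr rfl fun b _ => by ring
  rw [rowDefect_eq]
  constructor
  · intro h
    obtain ⟨R, norm_le, R_kerVec⟩ := exists_clm_kerVec_eq h
    exact ⟨R, norm_le, fun x b => by rw [R_kerVec]⟩
  · rintro ⟨R, norm_le, R_kerVec⟩
    have comp_eq : R ∘ kerVec H = v := by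
      ext x b : 2
      exact R_kerVec x b
    exact comp_eq ▸ posSemidef_gram_sub_gram_comp norm_le (kerVec H)

theorem exists_clm_kerVec_eq_smul {φ : ι → X → ℂ} (h : (rowDefect H φ).PosSemidef) (b : ι) :
    ∃ T : H →L[ℂ] H, ‖T‖ ≤ 1 ∧ ∀ x, T (kerVec H x) = conj (φ b x) • kerVec H x := by
  obtain ⟨R, norm_le, R_kerVec⟩ := posSemidef_rowDefect_iff.mp h
  refine ⟨PiLp.proj 2 (fun _ => H) b ∘L R, ?_, fun x => R_kerVec x b⟩
  exact ContinuousLinearMap.opNorm_le_bound _ zero_le_one fun f =>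
    (PiLp.norm_apply_le (R f) b).trans (R.le_of_opNorm_le norm_le f)

theorem mem_mult_of_posSemidef_rowDefect {φ : ι → X → ℂ} (h : (rowDefect H φ).PosSemidef)
    (b : ι) : φ b ∈ Mult H := by
  obtain ⟨T, -, T_kerVec⟩ := exists_clm_kerVec_eq_smul h b
  intro f
  refine ⟨T.adjoint f, funext fun x => ?_⟩
  rw [adjoint_apply_eq_inner, T_kerVec, inner_smul_left, inner_kerVec, Complex.conj_conj,
    Pi.mul_apply]

theorem posSemidef_rowDefect_of_norm_matrixMulOp_le {r : ℕ}
    {Φ : Matrix (Fin r) (Fin r) (Mult H)} (hΦ : ‖matrixMulOp Φ‖ ≤ 1) (a : Fin r) :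
    (rowDefect H fun b => (Φ a b : X → ℂ)).PosSemidef := by
  let row : PiLp 2 (fun _ : Fin r => H) →L[ℂ] H := PiLp.proj 2 (fun _ => H) a ∘L matrixMulOp Φ
  refine posSemidef_rowDefect_iff.mpr ⟨row.adjoint, ?_, fun x => ?_⟩
  · rw [LinearIsometryEquiv.norm_map]
    exact ContinuousLinearMap.opNorm_le_bound _ zero_le_one fun F =>
      (PiLp.norm_apply_le (matrixMulOp Φ F) a).trans ((matrixMulOp Φ).le_of_opNorm_le hΦ F)
  · suffices row.adjoint (kerVec H x) =
        WithLp.toLp 2 fun b => conj ((Φ a b : X → ℂ) x) • kerVec H x by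
      simp [this]
    refine ext_inner_right ℂ fun F => ?_
    have eval_sum (g : Fin r → H) : (∑ b, g b) x = ∑ b, g b x := by
      simp only [← inner_kerVec, inner_sum]
    simp [row, ContinuousLinearMap.adjoint_inner_left, inner_kerVec, matrixMulOp_apply,
      PiLp.inner_apply, inner_smul_left, mulOp_apply, eval_sum]

theorem IsCompletePick.exists_row (hpick : IsCompletePick H) {n r : ℕ} (z : Fin n → X)
    (A : Matrix (Fin n) (Fin (r + 1)) ℂ)
    (hA : (Matrix.of fun i j =>
      ker H (z i) (z j) * (1 - (A * A.conjTranspose) i j)).PosSemidef) :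
    ∃ φ : Fin (r + 1) → X → ℂ, (rowDefect H φ).PosSemidef ∧ ∀ i b, φ b (z i) = A i b := by
  let W (i : Fin n) : Matrix (Fin (r + 1)) (Fin (r + 1)) ℂ := .of fun a => if a = 0 then A i else 0
  have W_mul (i j) (a c) : (W i * (W j).conjTranspose) a c =
      if a = 0 ∧ c = 0 then (A * A.conjTranspose) i j else 0 := by
    by_cases ha : a = 0 <;> by_cases hc : c = 0 <;> simp [W, Matrix.mul_apply, ha, hc]
  -- The block matrix is `hA` in the `(0, 0)` corner and the kernel matrix along the other
  -- diagonal entries.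
  have corner := hA.kronecker (Matrix.PosSemidef.diagonal
    (d := fun a : Fin (r + 1) => if a = 0 then (1 : ℂ) else 0) fun a => by
      dsimp; split_ifs <;> simp)
  have diag := ((posSemidef_gram (kerVec H)).submatrix z).kronecker (Matrix.PosSemidef.diagonal
    (d := fun a : Fin (r + 1) => if a = 0 then (0 : ℂ) else 1) fun a => by
      dsimp; split_ifs <;> simp)
  have block_posSemidef : (Matrix.of fun p q : Fin n × Fin (r + 1) => ker H (z p.1) (z q.1) *
      (1 - W p.1 * (W q.1).conjTranspose) p.2 q.2).PosSemidef := by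
    refine (congrArg Matrix.PosSemidef ?_).mpr (corner.add diag)
    ext ⟨i, a⟩ ⟨j, c⟩
    simp only [gram_kerVec, Matrix.of_apply, Matrix.add_apply, Matrix.kronecker_apply,
      Matrix.submatrix_apply, Matrix.sub_apply, Matrix.diagonal_apply, W_mul, Matrix.one_apply]
    by_cases hac : a = c
    · by_cases ha : a = 0 <;> simp [← hac, ha]
    · have : ¬(a = 0 ∧ c = 0) := fun h => hac (h.1.trans h.2.symm)
      simp [hac, this]
  obtain ⟨Φ, norm_le, Φ_apply⟩ := hpick (r + 1) n z W block_posSemidef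
  exact ⟨fun b => Φ 0 b, posSemidef_rowDefect_of_norm_matrixMulOp_le norm_le 0, fun i b => by
    simp [Φ_apply, W]⟩

end Row

section McCulloughQuiggin

variable {X : Type*} {H : Type*} [NormedAddCommGroup H] [InnerProductSpace ℂ H] [RKHS ℂ H X ℂ]
  [CompleteSpace H]

theorem ker_ne_zero (hnorm : IsNormalized H) (hpick : IsCompletePick H) (x y : X) :
    ker H x y ≠ 0 := by
  intro hxy
  have hyx : ker H y x = 0 := by rw [← conj_ker, hxy, map_zero]
  obtain ⟨x₀, hx₀⟩ := id hnorm
  -- A contractive multiplier with the values `1` at `x` and `-1` at `y` would have both values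
  -- at `x₀`.
  obtain ⟨φ, rowDefect_posSemidef, φ_apply⟩ := hpick.exists_row ![x, y] !![1; -1] <| by
    refine (congrArg Matrix.PosSemidef ?_).mpr Matrix.PosSemidef.zero
    ext i j
    fin_cases i <;> fin_cases j <;> simp [Matrix.mul_apply, hxy, hyx]
  obtain ⟨T, norm_le, T_kerVec⟩ := exists_clm_kerVec_eq_smul rowDefect_posSemidef 0
  have φ_x₀ (z : X) (hz : ‖φ 0 z‖ = 1) : φ 0 x₀ = φ 0 z := by
    by_contra hne
    have orthogonal := inner_eq_zero_of_unimodular_eigenvector norm_le (by simpa using hz)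
      ((RingHom.injective conj).ne (Ne.symm hne)) (T_kerVec z) (T_kerVec x₀)
    simp [inner_kerVec_kerVec, hx₀] at orthogonal
  have φ_x : φ 0 x = 1 := by simpa using φ_apply 0 0
  have φ_y : φ 0 y = -1 := by simpa using φ_apply 1 0
  have one_eq_neg_one : (1 : ℂ) = -1 :=
    calc 1 = φ 0 x := φ_x.symm
      _ = φ 0 x₀ := (φ_x₀ x (by simp [φ_x])).symm
      _ = φ 0 y := φ_x₀ y (by simp [φ_y])
      _ = -1 := φ_y
  norm_num at one_eq_neg_one

variable (H) in
/-- The reproducing kernel of the subspace `{f ∈ H | f(y) = 0}`. -/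
noncomputable def vanishingKer (y z w : X) : ℂ :=
  ker H z w - ker H z y * ker H y w / ker H y y

variable (H) in
/-- The orthogonal projection of `H` onto `{f ∈ H | f(y) = 0}`. -/
noncomputable def vanishingProj (y : X) : H →L[ℂ] H := (ℂ ∙ kerVec H y)ᗮ.starProjection

theorem norm_vanishingProj_le (y : X) : ‖vanishingProj H y‖ ≤ 1 :=
  Submodule.starProjection_norm_le _

theorem vanishingProj_kerVec_self (y : X) : vanishingProj H y (kerVec H y) = 0 :=
  (Submodule.starProjection_apply_eq_zero_iff _).mpr <|
    Submodule.le_orthogonal_orthogonal _ (Submodule.mem_span_singleton_self _)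

theorem vanishingProj_apply (y : X) (f : H) :
    vanishingProj H y f = f - (f y / ker H y y) • kerVec H y := by
  rw [vanishingProj, Submodule.starProjection_orthogonal_val, Submodule.starProjection_singleton,
    inner_kerVec, ker_self]
  norm_cast

theorem inner_vanishingProj_kerVec (y z w : X) :
    ⟪vanishingProj H y (kerVec H z), vanishingProj H y (kerVec H w)⟫_ℂ =
      vanishingKer H y z w := by
  have idempotent : vanishingProj H y (vanishingProj H y (kerVec H w)) =
      vanishingProj H y (kerVec H w) :=
    DFunLike.congr_fun (Submodule.isIdempotentElem_starProjection _).eq (kerVec H w)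
  rw [vanishingProj, Submodule.inner_starProjection_left_eq_right, ← vanishingProj, idempotent,
    vanishingProj_apply, inner_sub_right, inner_smul_right, inner_kerVec_kerVec,
    inner_kerVec_kerVec, kerVec_apply, vanishingKer]
  ring

theorem posSemidef_vanishingKer_mul {ι : Type*} [Fintype ι] {φ : ι → X → ℂ}
    (h : (rowDefect H φ).PosSemidef) (y : X) :
    (Matrix.of fun z w =>
      vanishingKer H y z w * (1 - ∑ b, φ b z * conj (φ b w))).PosSemidef := by
  obtain ⟨R, norm_le, R_kerVec⟩ := posSemidef_rowDefect_iff.mp h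
  let v (z : X) : H := vanishingProj H y (kerVec H z)
  have compressed_row (b : ι) (z : X) : vanishingProj H y (R (v z) b) = conj (φ b z) • v z := by
    have entry : R (v z) b = conj (φ b z) • kerVec H z -
        (kerVec H z y / ker H y y) • conj (φ b y) • kerVec H y := by
      simp only [v, vanishingProj_apply, map_sub, map_smul, PiLp.sub_apply, PiLp.smul_apply,
        R_kerVec]
    rw [entry, map_sub, map_smul, map_smul, map_smul, vanishingProj_kerVec_self, smul_zero,
      smul_zero, sub_zero]
  have row_contraction := posSemidef_gram_sub_gram_comp norm_le v
  have entry_contraction (b : ι) :=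
    posSemidef_gram_sub_gram_comp (norm_vanishingProj_le (H := H) y) fun z => R (v z) b
  refine (congrArg Matrix.PosSemidef ?_).mpr
    (row_contraction.add (Matrix.posSemidef_sum Finset.univ fun b _ => entry_contraction b))
  ext z w
  simp only [Matrix.of_apply, Matrix.add_apply, Matrix.sub_apply, Matrix.sum_apply,
    Matrix.gram_apply, Function.comp_apply, compressed_row, PiLp.inner_apply,
    Finset.sum_sub_distrib, sub_add_sub_cancel, inner_smul_left, inner_smul_right,
    Complex.conj_conj, v, inner_vanishingProj_kerVec, mul_sub, mul_one, Finset.mul_sum]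
  congr 1
  exact Finset.sum_congr rfl fun b _ => by ring

variable (H) in
/-- The matrix `1 - k(z, y) k(y, w) / (k(z, w) k(y, y))`. By the theorem of McCullough and Quiggin
its positive semidefiniteness characterizes complete Pick kernels; for the base point of a
normalized kernel it is `1 - 1 / k`. -/
noncomputable def quigginMatrix (y : X) : Matrix X X ℂ :=
  .of fun z w => 1 - ker H z y * ker H y w / (ker H z w * ker H y y)

theorem posSemidef_quigginMatrix_change_base (hnorm : IsNormalized H) (hpick : IsCompletePick H)
    {n : ℕ} (z : Fin (n + 1) → X) {u : X} (y : X)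
    (h : ((quigginMatrix H u).submatrix z z).PosSemidef) :
    ((quigginMatrix H y).submatrix z z).PosSemidef := by
  have hker := ker_ne_zero hnorm hpick
  let d (x : X) : ℂ := ker H x u / ‖kerVec H u‖
  have norm_ne_zero : (‖kerVec H u‖ : ℂ) ≠ 0 := fun h => hker u u (by simp [ker_self, h])
  have d_ne_zero (x : X) : d x ≠ 0 := div_ne_zero (hker x u) norm_ne_zero
  have ker_mul_one_sub (x w : X) : ker H x w * (1 - quigginMatrix H u x w) = d x * conj (d w) := by
    have := hker x w
    simp only [quigginMatrix, d, Matrix.of_apply, map_div₀, conj_ker, Complex.conj_ofReal, ker_self]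
    field_simp
    ring
  obtain ⟨A, hA⟩ : ∃ A, (quigginMatrix H u).submatrix z z = A * A.conjTranspose := by
    open scoped MatrixOrder in
    exact CStarAlgebra.nonneg_iff_eq_mul_star_self.mp h.nonneg
  have A_mul (i j) : (A * A.conjTranspose) i j = quigginMatrix H u (z i) (z j) := by
    rw [← hA, Matrix.submatrix_apply]
  obtain ⟨φ, rowDefect_posSemidef, φ_apply⟩ := hpick.exists_row z A <| by
    refine (congrArg Matrix.PosSemidef ?_).mpr (posSemidef_gram (𝕜 := ℂ) fun i => conj (d (z i)))
    ext i j
    simp [A_mul, ker_mul_one_sub, Matrix.gram_apply, mul_comm]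
  refine posSemidef_of_rescale (fun i => d_ne_zero (z i)) ((congrArg Matrix.PosSemidef ?_).mpr
    ((posSemidef_vanishingKer_mul rowDefect_posSemidef y).submatrix z))
  ext i j
  have φ_mul : ∑ b, φ b (z i) * conj (φ b (z j)) = quigginMatrix H u (z i) (z j) := by
    simp only [φ_apply, ← A_mul, Matrix.mul_apply, Matrix.conjTranspose_apply, RCLike.star_def]
  have vanishingKer_eq : vanishingKer H y (z i) (z j) =
      quigginMatrix H y (z i) (z j) * ker H (z i) (z j) := by
    have := hker (z i) (z j)
    simp only [vanishingKer, quigginMatrix, Matrix.of_apply]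
    field_simp
  simp only [Matrix.submatrix_apply, Matrix.of_apply, φ_mul, vanishingKer_eq]
  linear_combination -quigginMatrix H y (z i) (z j) * ker_mul_one_sub (z i) (z j)

theorem posSemidef_quigginMatrix (hnorm : IsNormalized H) (hpick : IsCompletePick H) (y : X) :
    (quigginMatrix H y).PosSemidef := by
  have hker := ker_ne_zero hnorm hpick
  refine posSemidef_of_forall_fin_submatrix fun n => ?_
  induction n generalizing y with
  | zero => exact fun z => Subsingleton.elim 0 ((quigginMatrix H y).submatrix z z) ▸ .zero
  | succ n ih =>
    intro z
    refine posSemidef_quigginMatrix_change_base hnorm hpick z y (u := z 0)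
      (posSemidef_of_zero_row_col (fun j => ?_) (fun i => ?_) (ih (z 0) (z ∘ Fin.succ)))
    · simp [quigginMatrix, mul_comm, hker]
    · simp [quigginMatrix, hker]

end McCulloughQuiggin

section PickEmbedding

open scoped TensorProduct

/-- The Hilbert space `ℂ ⊕ (G ⊗ H)`, which the row `(1, b)` of a Pick embedding `b : X → G` maps
contractively into `H`; see `IsPickEmbedding.exists_row_contraction`. -/
abbrev RowSpace (G H : Type*) [NormedAddCommGroup G] [InnerProductSpace ℂ G]
    [NormedAddCommGroup H] [InnerProductSpace ℂ H] : Type _ :=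
  WithLp 2 (ℂ × UniformSpace.Completion (G ⊗[ℂ] H))

/-- The vector `c ⊕ (β ⊗ g)` of `RowSpace G H`; a row is described by its values on these. -/
noncomputable def rowVec {G H : Type*} [NormedAddCommGroup G] [InnerProductSpace ℂ G]
    [NormedAddCommGroup H] [InnerProductSpace ℂ H] (c : ℂ) (β : G) (g : H) : RowSpace G H :=
  WithLp.toLp 2 (c, ((β ⊗ₜ[ℂ] g : G ⊗[ℂ] H) : UniformSpace.Completion (G ⊗[ℂ] H)))

theorem inner_rowVec {G H : Type*} [NormedAddCommGroup G] [InnerProductSpace ℂ G]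
    [NormedAddCommGroup H] [InnerProductSpace ℂ H] (c c' : ℂ) (β β' : G) (g g' : H) :
    ⟪rowVec c β g, rowVec c' β' g'⟫_ℂ = conj c * c' + ⟪β, β'⟫_ℂ * ⟪g, g'⟫_ℂ := by
  rw [rowVec, rowVec, WithLp.prod_inner_apply]
  simp [UniformSpace.Completion.inner_coe, mul_comm]

theorem norm_rowVec_zero {G H : Type*} [NormedAddCommGroup G] [InnerProductSpace ℂ G]
    [NormedAddCommGroup H] [InnerProductSpace ℂ H] (β : G) (g : H) :
    ‖rowVec 0 β g‖ = ‖β‖ * ‖g‖ := by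
  rw [rowVec, WithLp.prod_norm_eq_of_L2]
  simp [Real.sqrt_sq (mul_nonneg (norm_nonneg β) (norm_nonneg g))]

variable {X : Type*} {H : Type*} [NormedAddCommGroup H] [InnerProductSpace ℂ H] [RKHS ℂ H X ℂ]
  [CompleteSpace H] {G : Type*} [NormedAddCommGroup G] [InnerProductSpace ℂ G]

variable (H) in
/-- A map `b` into an inner product space with `k(x, y) = 1 / (1 - ⟪b x, b y⟫)`, that is, an
embedding of `H` into a Drury–Arveson space in the sense of Agler and McCarthy. -/
def IsPickEmbedding (b : X → G) : Prop :=
  ∀ x y, ker H x y * (1 - ⟪b x, b y⟫_ℂ) = 1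

theorem exists_isPickEmbedding.{u} {X : Type u} {H : Type*} [NormedAddCommGroup H]
    [InnerProductSpace ℂ H] [RKHS ℂ H X ℂ] [CompleteSpace H]
    (hnorm : IsNormalized H) (hpick : IsCompletePick H) :
    ∃ (G : Type u) (_ : NormedAddCommGroup G) (_ : InnerProductSpace ℂ G) (b : X → G),
      IsPickEmbedding H b := by
  have hker := ker_ne_zero hnorm hpick
  obtain ⟨x₀, hx₀⟩ := id hnorm
  obtain ⟨G, _, _, b, quigginMatrix_eq⟩ :=
    exists_eq_gram (posSemidef_quigginMatrix hnorm hpick x₀)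
  refine ⟨G, inferInstance, inferInstance, b, fun x y => ?_⟩
  have hx₀' : ker H x₀ y = 1 := by rw [← conj_ker, hx₀, map_one]
  have := hker x y
  rw [← Matrix.gram_apply, ← quigginMatrix_eq, quigginMatrix, Matrix.of_apply, hx₀, hx₀, hx₀']
  field_simp
  ring

variable {b : X → G}

theorem IsPickEmbedding.norm_lt_one (hb : IsPickEmbedding H b) (z : X) : ‖b z‖ < 1 := by
  have norm_sq_mul : ‖kerVec H z‖ ^ 2 * (1 - ‖b z‖ ^ 2) = 1 := by
    have := hb z z
    rw [ker_self, inner_self_eq_norm_sq_to_K, RCLike.ofReal_eq_complex_ofReal] at this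
    exact_mod_cast this
  have := pos_of_mul_pos_right (norm_sq_mul.symm ▸ zero_lt_one) (sq_nonneg ‖kerVec H z‖)
  nlinarith [norm_nonneg (b z)]

theorem IsPickEmbedding.exists_row_contraction (hb : IsPickEmbedding H b) :
    ∃ V : RowSpace G H →L[ℂ] H, ‖V‖ ≤ 1 ∧
      ∀ c β g x, V (rowVec c β g) x = c + ⟪b x, β⟫_ℂ * g x := by
  let v (x : X) : RowSpace G H := rowVec 1 (b x) (kerVec H x)
  have gram_eq : Matrix.gram ℂ (kerVec H : X → H) = Matrix.gram ℂ v := by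
    ext x y
    simp only [v, Matrix.gram_apply, inner_rowVec, inner_kerVec_kerVec, map_one]
    linear_combination hb x y
  obtain ⟨T, norm_le, T_kerVec⟩ := exists_clm_kerVec_eq (H := H) (v := v) <|
    (congrArg Matrix.PosSemidef (sub_eq_zero.mpr gram_eq)).mpr .zero
  refine ⟨T.adjoint, (LinearIsometryEquiv.norm_map _ T).trans_le norm_le, fun c β g x => ?_⟩
  rw [adjoint_apply_eq_inner, T_kerVec, inner_rowVec, inner_kerVec, map_one, one_mul]

theorem IsPickEmbedding.exists_clm_eq_inner_mul (hb : IsPickEmbedding H b) (β : G) :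
    ∃ A : H →L[ℂ] H, ‖A‖ ≤ ‖β‖ ∧ ∀ g x, A g x = ⟪b x, β⟫_ℂ * g x := by
  obtain ⟨V, norm_le, V_rowVec⟩ := hb.exists_row_contraction
  have V_rowVec_zero (g x) : V (rowVec 0 β g) x = ⟪b x, β⟫_ℂ * g x := by
    rw [V_rowVec, zero_add]
  let A : H →ₗ[ℂ] H :=
    { toFun g := V (rowVec 0 β g)
      map_add' g h := by ext x; simp [V_rowVec_zero, mul_add]
      map_smul' c g := by ext x; simp [V_rowVec_zero, mul_left_comm] }
  have bound (g : H) : ‖A g‖ ≤ ‖β‖ * ‖g‖ :=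
    (V.le_of_opNorm_le norm_le _).trans_eq ((one_mul _).trans (norm_rowVec_zero β g))
  exact ⟨A.mkContinuous ‖β‖ bound, A.mkContinuous_norm_le (norm_nonneg β) bound, V_rowVec_zero⟩

/-- As `k(·, z) = 1 / (1 - ⟪b ·, b z⟫)`, the product is obtained by inverting `1 - ⟪b ·, b z⟫` in
the multiplier algebra. -/
theorem IsPickEmbedding.exists_eq_ker_mul (hb : IsPickEmbedding H b) (f : H) (z : X) :
    ∃ g : H, (∀ x, g x = ker H x z * f x) ∧ ‖g - f‖ ≤ ‖g‖ := by
  obtain ⟨A, norm_A_le, A_apply⟩ := hb.exists_clm_eq_inner_mul (b z)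
  obtain ⟨u, hu⟩ := isUnit_one_sub_of_norm_lt_one (norm_A_le.trans_lt (hb.norm_lt_one z))
  let g : H := (↑u⁻¹ : H →L[ℂ] H) f
  have g_sub : g - A g = f := by
    have : (u * ↑u⁻¹ : H →L[ℂ] H) f = f := by rw [Units.mul_inv]; rfl
    rwa [hu] at this
  refine ⟨g, fun x => ?_, ?_⟩
  · rw [← g_sub, RKHS.coe_sub, Pi.sub_apply, A_apply]
    linear_combination -g x * hb x z
  · rw [← g_sub, sub_sub_cancel]
    exact (A.le_of_opNorm_le (norm_A_le.trans (hb.norm_lt_one z).le) g).trans_eq (one_mul _)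

theorem IsPickEmbedding.posSemidef_realization (hb : IsPickEmbedding H b) {l h : X → H}
    (hlh : ∀ z x, h z x = 1 + ⟪b x, b z⟫_ℂ * l z x) :
    (Matrix.of fun z w =>
      ker H z w * (1 + ⟪l z, l w⟫_ℂ - ⟪h z, h w⟫_ℂ)).PosSemidef := by
  obtain ⟨V, norm_le, V_rowVec⟩ := hb.exists_row_contraction
  let ξ (z : X) : RowSpace G H := rowVec 1 (b z) (l z)
  have V_ξ (z : X) : V (ξ z) = h z := by
    ext x
    rw [V_rowVec, hlh]
  have row_contraction := posSemidef_gram_sub_gram_comp norm_le ξ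
  refine (congrArg Matrix.PosSemidef ?_).mpr
    (((posSemidef_gram (kerVec H)).hadamard row_contraction).add (posSemidef_gram l))
  ext z w
  simp only [gram_kerVec, Matrix.of_apply, Matrix.add_apply, Matrix.hadamard_apply,
    Matrix.sub_apply, Matrix.gram_apply, Function.comp_apply, V_ξ]
  rw [inner_rowVec, map_one]
  linear_combination ⟪l z, l w⟫_ℂ * hb z w

/-- With `φ(z) = f(z) / ⟪g_z, f⟫`, the vector `l_z = k_z - conj φ(z) g_z` is orthogonal to `f`, so
`h_z = l_z + conj φ(z) f` satisfies `⟪h_z, h_w⟫ - ⟪l_z, l_w⟫ = ‖f‖² φ(z) conj φ(w)`. -/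
theorem IsPickEmbedding.posSemidef_rowDefect (hb : IsPickEmbedding H b) {f : H} {g : X → H}
    (hg : ∀ z x, g z x = ker H x z * f x) (hgf : ∀ z, ⟪g z, f⟫_ℂ ≠ 0) :
    (rowDefect H fun (_ : Unit) z => ‖f‖ * (f z / ⟪g z, f⟫_ℂ)).PosSemidef := by
  let φ (z : X) : ℂ := f z / ⟪g z, f⟫_ℂ
  let l (z : X) : H := kerVec H z - conj (φ z) • g z
  let h (z : X) : H := l z + conj (φ z) • f
  have inner_l_f (z : X) : ⟪l z, f⟫_ℂ = 0 := by
    simp only [l, φ, inner_sub_left, inner_smul_left, inner_kerVec, Complex.conj_conj]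
    rw [div_mul_cancel₀ _ (hgf z), sub_self]
  have inner_f_l (z : X) : ⟪f, l z⟫_ℂ = 0 := inner_eq_zero_symm.mp (inner_l_f z)
  have h_apply (z x : X) : h z x = 1 + ⟪b x, b z⟫_ℂ * l z x := by
    simp only [h, l, RKHS.coe_add, RKHS.coe_sub, RKHS.coe_smul, Pi.add_apply, Pi.sub_apply,
      Pi.smul_apply, smul_eq_mul, kerVec_apply, hg]
    linear_combination (1 - conj (φ z) * f x) * hb x z
  refine (congrArg Matrix.PosSemidef ?_).mpr (hb.posSemidef_realization h_apply)
  ext z w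
  have inner_h : ⟪h z, h w⟫_ℂ = ⟪l z, l w⟫_ℂ + ‖f‖ ^ 2 * (φ z * conj (φ w)) := by
    simp only [h, inner_add_left, inner_add_right, inner_smul_left, inner_smul_right, inner_l_f,
      inner_f_l, inner_self_eq_norm_sq_to_K, Complex.conj_conj,
      RCLike.ofReal_eq_complex_ofReal]
    ring
  simp only [rowDefect, Matrix.of_apply, inner_h, Fintype.sum_unique, map_mul, Complex.conj_ofReal]
  ring

theorem exists_mult_eq_zero_iff (hnorm : IsNormalized H) (hpick : IsCompletePick H) (f : H) :
    ∃ φ ∈ Mult H, ∀ x : X, φ x = 0 ↔ f x = 0 := by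
  rcases eq_or_ne f 0 with rfl | hf
  · exact ⟨0, zero_mem _, by simp⟩
  obtain ⟨G, _, _, b, hb⟩ := exists_isPickEmbedding hnorm hpick
  choose g hg norm_sub_le using hb.exists_eq_ker_mul f
  have hgf (z : X) : ⟪g z, f⟫_ℂ ≠ 0 := inner_ne_zero_of_norm_sub_le (norm_sub_le z) hf
  exact ⟨_, mem_mult_of_posSemidef_rowDefect (hb.posSemidef_rowDefect hg hgf) (), fun x => by
    simp [hf, hgf]⟩

end PickEmbedding

section ZeroSets

theorem IsZeroSet.union {X σ : Type*} [SetLike σ (X → ℂ)] [MulMemClass σ (X → ℂ)] {S : σ}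
    {Z₁ Z₂ : Set X} (h₁ : IsZeroSet (S : Set (X → ℂ)) Z₁) (h₂ : IsZeroSet (S : Set (X → ℂ)) Z₂) :
    IsZeroSet (S : Set (X → ℂ)) (Z₁ ∪ Z₂) := by
  obtain ⟨f₁, hf₁, zeros₁⟩ := h₁
  obtain ⟨f₂, hf₂, zeros₂⟩ := h₂
  exact ⟨f₁ * f₂, mul_mem hf₁ hf₂, fun x => by
    rw [Pi.mul_apply, mul_eq_zero, zeros₁ x, zeros₂ x, Set.mem_union]⟩

variable {X : Type*} {H : Type*} [NormedAddCommGroup H] [InnerProductSpace ℂ H] [RKHS ℂ H X ℂ]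
  [CompleteSpace H]

theorem exists_coe_eq_one (hnorm : IsNormalized H) : ∃ e : H, (⇑e : X → ℂ) = 1 := by
  obtain ⟨x₀, hx₀⟩ := hnorm
  exact ⟨kerVec H x₀, funext fun x => by rw [kerVec_apply, hx₀, Pi.one_apply]⟩

theorem IsCyclic.apply_ne_zero (hnorm : IsNormalized H) {ψ : Mult H} (hψ : IsCyclic ψ) (x : X) :
    (ψ : X → ℂ) x ≠ 0 := by
  intro hψx
  obtain ⟨e, he⟩ := exists_coe_eq_one hnorm
  have isClosed_vanishing : IsClosed {g : H | g x = 0} :=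
    isClosed_eq (RKHS.continuous_eval (𝕜 := ℂ) x) continuous_const
  have range_subset : Set.range (mulOp ψ) ⊆ {g : H | g x = 0} := by
    rintro _ ⟨g, rfl⟩
    simp [mulOp_apply, hψx]
  have : e x = 0 := isClosed_vanishing.closure_subset_iff.mpr range_subset (hψ e)
  simp [he] at this

theorem isCyclic_one : IsCyclic (1 : Mult H) := by
  refine Function.Surjective.denseRange fun g => ⟨g, ?_⟩
  ext x
  simp [mulOp_apply]

theorem isZeroSet_functions_iff (hnorm : IsNormalized H) (hpick : IsCompletePick H) (Z : Set X) :
    IsZeroSet (functions H) Z ↔ IsZeroSet (Mult H : Set (X → ℂ)) Z := by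
  constructor
  · rintro ⟨_, ⟨f, rfl⟩, hf⟩
    obtain ⟨φ, hφ, h⟩ := exists_mult_eq_zero_iff hnorm hpick f
    exact ⟨φ, hφ, fun x => (h x).trans (hf x)⟩
  · rintro ⟨φ, hφ, h⟩
    obtain ⟨e, he⟩ := exists_coe_eq_one hnorm
    obtain ⟨g, hg⟩ := hφ e
    exact ⟨φ, ⟨g, by simp [hg, he]⟩, h⟩

theorem isZeroSet_mult_iff (hnorm : IsNormalized H) (Z : Set X) :
    IsZeroSet (Mult H : Set (X → ℂ)) Z ↔ IsZeroSet (Smirnov H) Z := by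
  constructor
  · rintro ⟨φ, hφ, h⟩
    exact ⟨φ, ⟨⟨φ, hφ⟩, 1, isCyclic_one, by simp⟩, h⟩
  · rintro ⟨_, ⟨φ, ψ, hψ, rfl⟩, h⟩
    refine ⟨φ, φ.2, fun x => ?_⟩
    rw [← h x]
    simp [hψ.apply_ne_zero hnorm x]

end ZeroSets

end CompletePick

theorem corollary1p2 {X : Type*} (H : Type*) [NormedAddCommGroup H] [InnerProductSpace ℂ H]
    [CompleteSpace H] [RKHS ℂ H X ℂ]
    (hnorm : CompletePick.IsNormalized H) (hpick : CompletePick.IsCompletePick H) :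
    (∀ Z : Set X,
      (CompletePick.IsZeroSet (CompletePick.functions H) Z ↔
        CompletePick.IsZeroSet (CompletePick.Mult H : Set (X → ℂ)) Z) ∧
      (CompletePick.IsZeroSet (CompletePick.Mult H : Set (X → ℂ)) Z ↔
        CompletePick.IsZeroSet (CompletePick.Smirnov H) Z)) ∧
    ∀ Z₁ Z₂ : Set X,
      CompletePick.IsZeroSet (CompletePick.functions H) Z₁ →
      CompletePick.IsZeroSet (CompletePick.functions H) Z₂ →
      CompletePick.IsZeroSet (CompletePick.functions H) (Z₁ ∪ Z₂) := by
  refine ⟨fun Z => ⟨CompletePick.isZeroSet_functions_iff hnorm hpick Z,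
    CompletePick.isZeroSet_mult_iff hnorm Z⟩, fun Z₁ Z₂ h₁ h₂ => ?_⟩
  rw [CompletePick.isZeroSet_functions_iff hnorm hpick] at h₁ h₂ ⊢
  exact h₁.union h₂
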